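/- Let $K$ be a field of characteristic different from $2$, let $V$ be a $K$-vector space of finite dimension $n$, and let $G$ be a finite group acting linearly (not necessarily faithfully) on $V$. Let $K[V]=\operatorname{Sym}(V^*)$, with the induced action of $G$. Suppose that the ring of invariants $K[V]^G$ is isomorphic, as a $K$-algebra, to a polynomial ring, and that some element of $G$ acts on $V$ as a reflection, i.e. as a linear map of order $2$ which fixes a hyperplane pointwise. Definitions. Let $\operatorname{GW}(K)$ be the group completion, under orthogonal direct sum, of the monoid of isomorphism classes of nondegenerate symmetric bilinear forms on finite-dimensional $K$-vector spaces, and for $u\in K^\times$ let $\langle u\rangle\in\operatorname{GW}(K)$ be the class of the form $(x,y)\mapsto uxy$ on $K$. Let $f=(f_1,\dots,f_n)\colon\mathbb A^n\to\mathbb A^n$ be a morphism with $f(0)=0$ such that $0$ is isolated in $f^{-1}(0)$. Put $Q(f)=K[x_1,\dots,x_n]_{(x_1,\dots,x_n)}/(f_1,\dots,f_n)$ and $\deg_0 f=\dim_K Q(f)$. Write $f_i=\sum_j a_{ij}x_j$ with $a_{ij}\in K[x_1,\dots,x_n]$, and let $E(f)\in Q(f)$ be the image of $\det(a_{ij})$.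 The EKL-degree $\deg_0^{\mathrm{EKL}}f\in\operatorname{GW}(K)$ is the class of the form $\beta_\phi(a,b)=\phi(ab)$ on $Q(f)$, where $\phi\colon Q(f)\to K$ is any $K$-linear functional with $\phi(E(f))=1$. Statement. Both $K[V]$ and $K[V]^G$ admit systems of $n$ algebraically independent generators which vanish at the origin $0\in V$. For every choice of two such systems, let $\pi\colon\mathbb A^n\to\mathbb A^n$ be the map that corresponds, under the resulting identifications $\operatorname{Spec}K[V]\cong\mathbb A^n\cong\operatorname{Spec}K[V]^G$, to the quotient map $\operatorname{Spec}K[V]\to\operatorname{Spec}K[V]^G$. Then $\pi(0)=0$, the point $0$ is isolated in $\pi^{-1}(0)$, the EKL-degree of $\pi$ is well defined (a matrix $(a_{ij})$ and a functional $\phi$ as above exist, and for every such choice $\beta_\phi$ is nondegenerate and has the same class), the integer $\deg_0\pi$ is even, and $$\deg_0^{\mathrm{EKL}}\pi=\frac{\deg_0\pi}{2}\cdot\bigl(\langle 1\rangle+\langle -1\rangle\bigr).$$ -/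

import Mathlib

universe u v w

noncomputable section

namespace EKL

/-! ### The Grothendieck–Witt group -/

/-- A finite-dimensional `K`-vector space with a nondegenerate symmetric bilinear form. -/
structure SymBilinSpace (K : Type u) [Field K] : Type (u + 1) where
  carrier : Type u
  [addCommGroup : AddCommGroup carrier]
  [module : Module K carrier]
  [finite : Module.Finite K carrier]
  form : LinearMap.BilinForm K carrier
  isSymm : form.IsSymm
  nondegenerate : form.Nondegenerate

attribute [instance] SymBilinSpace.addCommGroup SymBilinSpace.module SymBilinSpace.finite

variable {K : Type u} [Field K]

/-- The orthogonal direct sum of two bilinear forms,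
`(v₁, v₂), (w₁, w₂) ↦ B₁ v₁ w₁ + B₂ v₂ w₂`. -/
def directSumForm {V W : Type*} [AddCommGroup V] [Module K V] [AddCommGroup W] [Module K W]
    (B₁ : LinearMap.BilinForm K V) (B₂ : LinearMap.BilinForm K W) :
    LinearMap.BilinForm K (V × W) :=
  B₁.compl₁₂ (LinearMap.fst K V W) (LinearMap.fst K V W) +
    B₂.compl₁₂ (LinearMap.snd K V W) (LinearMap.snd K V W)

@[simp]
theorem directSumForm_apply {V W : Type*} [AddCommGroup V] [Module K V] [AddCommGroup W]
    [Module K W] (B₁ : LinearMap.BilinForm K V) (B₂ : LinearMap.BilinForm K W) (x y : V × W) :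
    directSumForm B₁ B₂ x y = B₁ x.1 y.1 + B₂ x.2 y.2 := rfl

namespace SymBilinSpace

/-- Orthogonal direct sum. -/
def sum (S T : SymBilinSpace K) : SymBilinSpace K where
  carrier := S.carrier × T.carrier
  form := directSumForm S.form T.form
  isSymm := ⟨fun x y => by
    simp only [directSumForm_apply]; rw [S.isSymm.eq, T.isSymm.eq]⟩
  nondegenerate := by
    refine ⟨fun x hx => Prod.ext ?_ ?_, fun y hy => Prod.ext ?_ ?_⟩
    · exact S.nondegenerate.1 _ fun v => by simpa using hx (v, 0)
    · exact T.nondegenerate.1 _ fun v => by simpa using hx (0, v)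
    · exact S.nondegenerate.2 _ fun v => by simpa using hy (v, 0)
    · exact T.nondegenerate.2 _ fun v => by simpa using hy (0, v)

/-- The zero space. -/
def zero : SymBilinSpace K where
  carrier := PUnit.{u + 1}
  form := 0
  isSymm := ⟨fun _ _ => rfl⟩
  nondegenerate := ⟨fun _ _ => rfl, fun _ _ => rfl⟩

/-- Isometry of bilinear spaces. -/
instance setoid : Setoid (SymBilinSpace K) where
  r S T := S.form.Equivalent T.form
  iseqv := ⟨fun S => .refl S.form, fun h => h.symm, fun h h' => h.trans h'⟩

end SymBilinSpace

/-- Isomorphism classes of nondegenerate symmetric bilinear forms on finite-dimensional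
`K`-vector spaces. -/
def IsometryClass (K : Type u) [Field K] : Type (u + 1) :=
  Quotient (SymBilinSpace.setoid (K := K))

instance : Zero (IsometryClass K) := ⟨Quotient.mk _ SymBilinSpace.zero⟩

instance : Add (IsometryClass K) where
  add := Quotient.map₂ SymBilinSpace.sum (by
    rintro S S' ⟨e⟩ T T' ⟨e'⟩
    exact ⟨{ LinearEquiv.prodCongr e.toLinearEquiv e'.toLinearEquiv with
      map_app' := fun x y => congrArg₂ (· + ·) (e.map_app' x.1 y.1) (e'.map_app' x.2 y.2) }⟩)

/-- Isometry classes form a commutative monoid under orthogonal direct sum. -/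
instance : AddCommMonoid (IsometryClass K) where
  add_assoc := by
    rintro ⟨S⟩ ⟨T⟩ ⟨U⟩
    exact Quotient.sound ⟨{ LinearEquiv.prodAssoc K S.carrier T.carrier U.carrier with
      map_app' := fun x y => (add_assoc _ _ _).symm }⟩
  zero_add := by
    rintro ⟨S⟩
    exact Quotient.sound ⟨{ LinearEquiv.uniqueProd (R := K) (M := S.carrier) (M₂ := PUnit.{u + 1}) with
      map_app' := fun x y => (zero_add _).symm }⟩
  add_zero := by
    rintro ⟨S⟩
    exact Quotient.sound ⟨{ LinearEquiv.prodUnique (R := K) (M := S.carrier) (M₂ := PUnit.{u + 1}) with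
      map_app' := fun x y => (add_zero _).symm }⟩
  add_comm := by
    rintro ⟨S⟩ ⟨T⟩
    exact Quotient.sound ⟨{ LinearEquiv.prodComm K S.carrier T.carrier with
      map_app' := fun x y => add_comm _ _ }⟩
  nsmul := nsmulRec

/-- The Grothendieck–Witt group `GW(K)`: the group completion of the monoid of isometry classes
of nondegenerate symmetric bilinear forms. (This is the additive group of the
Grothendieck–Witt ring; the multiplication induced by the tensor product is not needed here.) -/
abbrev GW (K : Type u) [Field K] : Type (u + 1) :=
  Algebra.GrothendieckAddGroup (IsometryClass K)

/-- The class in `GW(K)` of a nondegenerate symmetric bilinear form. -/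
def GW.mk {V : Type u} [AddCommGroup V] [Module K V] [Module.Finite K V]
    (B : LinearMap.BilinForm K V) (hs : B.IsSymm) (hn : B.Nondegenerate) : GW K :=
  Algebra.GrothendieckAddGroup.of
    (Quotient.mk SymBilinSpace.setoid ⟨V, B, hs, hn⟩ : IsometryClass K)

/-- The bilinear form `(x, y) ↦ u * x * y` on `K`. -/
def rankOneForm (u : Kˣ) : LinearMap.BilinForm K K := (u : K) • LinearMap.mul K K

@[simp]
theorem rankOneForm_apply (u : Kˣ) (x y : K) : rankOneForm u x y = u * (x * y) := rfl

/-- `⟨u⟩ ∈ GW(K)`, the class of the form `(x, y) ↦ u * x * y` on `K`. -/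
def GW.unit (u : Kˣ) : GW K :=
  GW.mk (rankOneForm u) ⟨fun x y => by simp [mul_comm x y]⟩
    ⟨fun x hx => by simpa using hx 1, fun y hy => by simpa using hy 1⟩

/-! ### The EKL-degree at the origin of a map `𝔸ⁿ → 𝔸ⁿ` -/

section Degree

variable {n : ℕ}

/-- The maximal ideal `m₀ ⊆ K[x₁, …, xₙ]` of the origin. -/
def originIdeal (K : Type u) [Field K] (n : ℕ) : Ideal (MvPolynomial (Fin n) K) :=
  RingHom.ker (MvPolynomial.constantCoeff : MvPolynomial (Fin n) K →+* K)

instance : (originIdeal K n).IsPrime := RingHom.ker_isPrime _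

/-- The local algebra `Q(f) = K[x₁, …, xₙ]_{m₀} / (f₁, …, fₙ)` of the map
`f = (f₁, …, fₙ) : 𝔸ⁿ → 𝔸ⁿ` at the origin. -/
def LocalAlgebra (f : Fin n → MvPolynomial (Fin n) K) : Type u :=
  Localization.AtPrime (originIdeal K n) ⧸
    Ideal.span (Set.range fun i =>
      algebraMap (MvPolynomial (Fin n) K) (Localization.AtPrime (originIdeal K n)) (f i))

instance (f : Fin n → MvPolynomial (Fin n) K) : CommRing (LocalAlgebra f) :=
  inferInstanceAs (CommRing (_ ⧸ Ideal.span (Set.range fun i =>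
    algebraMap (MvPolynomial (Fin n) K) (Localization.AtPrime (originIdeal K n)) (f i))))

instance (f : Fin n → MvPolynomial (Fin n) K) : Algebra K (LocalAlgebra f) :=
  inferInstanceAs (Algebra K (_ ⧸ Ideal.span (Set.range fun i =>
    algebraMap (MvPolynomial (Fin n) K) (Localization.AtPrime (originIdeal K n)) (f i))))

/-- The image of a polynomial in `Q(f)`. -/
def toLocalAlgebra (f : Fin n → MvPolynomial (Fin n) K) :
    MvPolynomial (Fin n) K →+* LocalAlgebra f :=
  (Ideal.Quotient.mk (Ideal.span (Set.range fun i =>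
      algebraMap (MvPolynomial (Fin n) K) (Localization.AtPrime (originIdeal K n)) (f i)))).comp
    (algebraMap (MvPolynomial (Fin n) K) (Localization.AtPrime (originIdeal K n)))

/-- The degree `deg₀ f = dim_K Q(f)` of `f` at the origin of the source. -/
def localDegree (f : Fin n → MvPolynomial (Fin n) K) : ℕ :=
  Module.finrank K (LocalAlgebra f)

/-- The bilinear form `β_φ(a, b) = φ(a * b)` attached to a linear functional `φ : Q → K`. -/
def functionalForm {Q : Type*} [CommRing Q] [Algebra K Q] (φ : Q →ₗ[K] K) :
    LinearMap.BilinForm K Q :=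
  (LinearMap.mul K Q).compr₂ φ

theorem functionalForm_isSymm {Q : Type*} [CommRing Q] [Algebra K Q] (φ : Q →ₗ[K] K) :
    (functionalForm φ).IsSymm :=
  ⟨fun a b => congrArg φ (mul_comm a b)⟩

/-- `φ : Q(f) → K` is a linear functional which sends the distinguished socle element `E(f)` to
`1`, where `E(f)` is computed from the matrix `a`: here `fᵢ = ∑ⱼ aᵢⱼ xⱼ` and `E(f)` is the image
of `det a` in `Q(f)`. -/
structure IsAdmissible (f : Fin n → MvPolynomial (Fin n) K)
    (a : Matrix (Fin n) (Fin n) (MvPolynomial (Fin n) K)) (φ : LocalAlgebra f →ₗ[K] K) :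
    Prop where
  eq_sum : ∀ i, f i = ∑ j, a i j * MvPolynomial.X j
  map_socle : φ (toLocalAlgebra f a.det) = 1

/-- `f : 𝔸ⁿ → 𝔸ⁿ` sends `0` to `0`, the point `0` is isolated in its fibre `f⁻¹(0)` (that is, the
local algebra `Q(f)` is finite-dimensional), and the EKL-degree of `f` at the origin is `γ`:
the form `β_φ` is nondegenerate of class `γ` for every choice of the matrix `(aᵢⱼ)` and of the
functional `φ` with `φ(E(f)) = 1`, and such a choice exists. -/
structure HasEKLDegree (f : Fin n → MvPolynomial (Fin n) K) (γ : GW K) : Prop where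
  map_origin : ∀ i, MvPolynomial.constantCoeff (f i) = 0
  [isolated : Module.Finite K (LocalAlgebra f)]
  exists_admissible : ∃ a φ, IsAdmissible f a φ
  eq_class : ∀ (a : Matrix (Fin n) (Fin n) (MvPolynomial (Fin n) K)) (φ : LocalAlgebra f →ₗ[K] K),
    IsAdmissible f a φ → ∃ hn : (functionalForm φ).Nondegenerate,
    GW.mk (functionalForm φ) (functionalForm_isSymm φ) hn = γ

end Degree

/-! ### Pointed affine spaces in coordinates -/

/-- Let `A` be a `K`-algebra and `ε : A → K` a `K`-point of `Spec A`. An identification of `Spec A`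
with `𝔸ⁿ` which takes this point to the origin, i.e. a system of polynomial generators of `A`
which vanish at the point. -/
structure Coordinates {A : Type*} [CommRing A] [Algebra K A] (ε : A →ₐ[K] K) (n : ℕ) where
  equiv : MvPolynomial (Fin n) K ≃ₐ[K] A
  origin : ∀ i, ε (equiv (MvPolynomial.X i)) = 0

/-- The component functions, in given coordinates of the source `Spec A` and the target `Spec B`,
of the morphism `Spec A → Spec B` given by a homomorphism `F : B → A`. -/
def components {A B : Type*} [CommRing A] [Algebra K A] [CommRing B] [Algebra K B] {n : ℕ}
    {ε : A →ₐ[K] K} {δ : B →ₐ[K] K} (F : B →ₐ[K] A) (x : Coordinates ε n) (y : Coordinates δ n) :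
    Fin n → MvPolynomial (Fin n) K :=
  fun i => x.equiv.symm (F (y.equiv (MvPolynomial.X i)))

/-! ### Polynomial functions, invariants and reflections -/

section Invariants

variable {V : Type v} [AddCommGroup V] [Module K V] {G : Type w} [Group G]

/-- The ring `K[V] = Sym(V*)` of polynomial functions on `V`. -/
abbrev PolyFun (K : Type u) [Field K] (V : Type v) [AddCommGroup V] [Module K V] :
    Type (max u v) :=
  SymmetricAlgebra K (Module.Dual K V)

/-- The origin of `Spec K[V]`: evaluation at `0 ∈ V`, which kills all linear forms. -/
def originPoint (K : Type u) [Field K] (V : Type v) [AddCommGroup V] [Module K V] :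
    PolyFun K V →ₐ[K] K :=
  SymmetricAlgebra.algebraMapInv

/-- The action of `g` on `K[V]`, induced by its action `l ↦ l ∘ g⁻¹` on linear forms. -/
def polyAction (ρ : Representation K G V) (g : G) : PolyFun K V →ₐ[K] PolyFun K V :=
  SymmetricAlgebra.lift (SymmetricAlgebra.ι K (Module.Dual K V) ∘ₗ ρ.dual g)

/-- The ring `K[V]^G` of invariant polynomial functions. -/
def invariantRing (ρ : Representation K G V) : Subalgebra K (PolyFun K V) where
  carrier := {p | ∀ g, polyAction ρ g p = p}
  mul_mem' hp hq g := by rw [map_mul, hp g, hq g]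
  add_mem' hp hq g := by rw [map_add, hp g, hq g]
  algebraMap_mem' c g := (polyAction ρ g).commutes c

/-- The image of the origin in `Spec K[V]^G`. -/
def invariantOrigin (ρ : Representation K G V) : invariantRing ρ →ₐ[K] K :=
  (originPoint K V).comp (invariantRing ρ).val

/-- The linear map `s` is a reflection: `s y = y - l(y) x` for a vector `x` and a linear form `l`
with `l(x) = 2`. If the characteristic is not `2`, this says that `s² = 1` and that `s` fixes
a hyperplane pointwise and sends some vector `x ≠ 0` to `-x`. -/
def IsReflection (s : V →ₗ[K] V) : Prop :=
  ∃ (x : V) (l : Module.Dual K V) (h : l x = 2), s = (Module.reflection h : V ≃ₗ[K] V)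

end Invariants

end EKL

end

/-!
Let `S = K[V]`, let `R` be its ring of invariants and `𝔪` the ideal of the invariants which vanish
at the origin. The orbit polynomial `∏ (T - g p)` of a function `p` with `p(0) = 0` shows that `p`
is nilpotent modulo `𝔪 S`. Since the components `f` of `π` generate `𝔪 S`, the variables are
nilpotent in `S / (f)`, so this quotient is finite-dimensional, is already local, and is `Q = Q(π)`.

*The socle of `Q`.* Write `f = a x`. That `E = det a` is nonzero in `Q` follows by comparison with
the monomial complete intersection: if `b f = (xᵢ ^ N)`, then `det b * det a` agrees with
`∏ xᵢ ^ (N - 1)` modulo `(xᵢ ^ N)`, while `det b * (f) ⊆ (xᵢ ^ N)` (`det_notMem_span_range`).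
The Bezoutian of `f` in `Q ⊗ Q` then yields one functional on `Q` whose form is nondegenerate
(`IsLocalPresentation.exists_nondegenerate`). So the socle of `Q` is a line; by Cramer's rule it
contains `E`, and every functional with `φ(E) = 1` has a nondegenerate form. Two such functionals
differ by a unit congruent to `1` modulo the maximal ideal. It is a square because `2` is
invertible, so the forms are isometric (`IsLocalPresentation.mk_functionalForm_eq`).

*The reflection.* Let `s` be a reflection in `G`, with linear form `α`. If `α p = ∑ cᵢ fᵢ`, then
subtracting the image under `s` gives `α (p + s p) = ∑ (cᵢ - s cᵢ) fᵢ`; each `cᵢ - s cᵢ` is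
divisible by `α`, and cancelling `α` gives `p + s p ∈ (f)`. Thus `s` acts by `-1` on the
socle of `Q`. For admissible `φ` the functional `(φ - φ ∘ s) / 2` is admissible too, and it vanishes on the
`s`-invariants, so that the two eigenspaces of `s` on `Q` are totally isotropic and complementary.
Hence the form is hyperbolic (`GW.mk_eq_nsmul_of_isotropic`). No assumption on the order of `G`
is needed.
-/

namespace EKL

open MvPolynomial TensorProduct

/-! ### Cramer's rule and monomial ideals -/

/-- Cramer's rule modulo an ideal. -/
theorem det_mul_mem_of_forall_sum_mem {R ι : Type*} [CommRing R] [Fintype ι] [DecidableEq ι]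
    (J : Ideal R) (M : Matrix ι ι R) (x : ι → R) (h : ∀ i, ∑ j, M i j * x j ∈ J) (k : ι) :
    M.det * x k ∈ J := by
  have hk : M.det * x k = ∑ i, M.adjugate k i * ∑ j, M i j * x j := by
    have := congrFun (congrArg (fun N => Matrix.mulVec N x) M.adjugate_mul) k
    rw [← Matrix.mulVec_mulVec, Matrix.smul_mulVec, Matrix.one_mulVec] at this
    simpa [Matrix.mulVec, dotProduct] using this.symm
  rw [hk]
  exact J.sum_mem fun i _ => J.mul_mem_left _ (h i)

section Monomial

variable {R ι : Type*} [CommRing R]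

theorem mem_span_X_pow_image_iff (N : ℕ) (T : Set ι) (p : MvPolynomial ι R) :
    p ∈ Ideal.span ((fun i => (X i : MvPolynomial ι R) ^ N) '' T) ↔
      ∀ m ∈ p.support, ∃ i ∈ T, N ≤ m i := by
  have := mem_ideal_span_monomial_image (x := p) (s := (fun i => Finsupp.single i N) '' T)
  rw [Set.image_image] at this
  simpa [X_pow_eq_monomial] using this

theorem mem_span_X_pow_image_of_X_mul_mem {N : ℕ} {T : Set ι} {i : ι} (hi : i ∉ T)
    {p : MvPolynomial ι R}
    (h : X i * p ∈ Ideal.span ((fun i => (X i : MvPolynomial ι R) ^ N) '' T)) :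
    p ∈ Ideal.span ((fun i => (X i : MvPolynomial ι R) ^ N) '' T) := by
  classical
  rw [mem_span_X_pow_image_iff] at h ⊢
  intro m hm
  obtain ⟨l, hl, hN⟩ := h (m + Finsupp.single i 1) (by
    rw [mem_support_iff, mul_comm, coeff_mul_X]
    exact mem_support_iff.1 hm)
  have hli : i ≠ l := fun h => hi (h ▸ hl)
  exact ⟨l, hl, by simpa [Finsupp.single_apply, hli] using hN⟩

theorem prod_X_pow_notMem_span [Fintype ι] [Nontrivial R] (N : ℕ) :
    ∏ i, (X i : MvPolynomial ι R) ^ N ∉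
      Ideal.span ((fun i => (X i : MvPolynomial ι R) ^ (N + 1)) '' Set.univ) := by
  classical
  intro h
  have hm : ∏ i, (X i : MvPolynomial ι R) ^ N = monomial (∑ i, Finsupp.single i N) 1 := by
    simp only [X_pow_eq_monomial]
    rw [monomial_sum_one]
  rw [hm, mem_span_X_pow_image_iff] at h
  obtain ⟨i, -, hi⟩ := h (∑ i, Finsupp.single i N) (by simp [mem_support_iff])
  simp [Finsupp.finsetSum_apply, Finsupp.single_apply] at hi

/-- Two matrices which express the powers `Xᵢ ^ N` through the variables have the same determinant
modulo these powers. Replacing one row at a time reduces this to a determinant `D` with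
`Xᵢ * D ∈ (Xₗ ^ N : l ≠ i)`, and `Xᵢ` is a nonzerodivisor modulo that monomial ideal. -/
theorem det_sub_det_mem_span_X_pow [Fintype ι] [DecidableEq ι] (N : ℕ)
    (c d : Matrix ι ι (MvPolynomial ι R))
    (hc : ∀ i, ∑ j, c i j * X j = X i ^ N) (hd : ∀ i, ∑ j, d i j * X j = X i ^ N) :
    d.det - c.det ∈
      Ideal.span ((fun i => (X i : MvPolynomial ι R) ^ N) '' Set.univ) := by
  let e : Finset ι → Matrix ι ι (MvPolynomial ι R) := fun T =>
    Matrix.of fun i => if i ∈ T then d i else c i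
  have he : ∀ T i, ∑ j, e T i j * X j = X i ^ N := by
    intro T i
    by_cases h : i ∈ T
    · simpa [e, h] using hd i
    · simpa [e, h] using hc i
  suffices h : ∀ T, (e T).det - c.det ∈
      Ideal.span ((fun i => (X i : MvPolynomial ι R) ^ N) '' Set.univ) by
    have huniv : e Finset.univ = d := by ext i j; simp [e]
    simpa [huniv] using h Finset.univ
  intro T
  induction T using Finset.induction_on with
  | empty =>
    have : e ∅ = c := by ext i j; simp [e]
    simp [this]
  | insert i T hi ih =>
    have h1 : e (insert i T) = (e T).updateRow i (d i) := by
      refine Matrix.ext fun k l => ?_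
      by_cases hk : k = i <;> simp [e, Matrix.updateRow_apply, hk]
    have h2 : e T = (e T).updateRow i (c i) := by
      refine Matrix.ext fun k l => ?_
      by_cases hk : k = i <;> simp [e, Matrix.updateRow_apply, hk, hi]
    have h3 : (e (insert i T)).det - (e T).det = ((e T).updateRow i (d i - c i)).det := by
      rw [h1]
      nth_rewrite 2 [h2]
      exact (Matrix.detRowAlternating.map_update_sub (e T) i (d i) (c i)).symm
    have h4 : ((e T).updateRow i (d i - c i)).det ∈
        Ideal.span ((fun i => (X i : MvPolynomial ι R) ^ N) '' {i}ᶜ) := by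
      refine mem_span_X_pow_image_of_X_mul_mem (i := i) (by simp) ?_
      rw [mul_comm]
      refine det_mul_mem_of_forall_sum_mem _ _ X (fun k => ?_) i
      by_cases hk : k = i
      · subst hk
        simp [sub_mul, hc, hd]
      · simp only [Matrix.updateRow_ne hk, he]
        exact Ideal.subset_span ⟨k, by simpa using hk, rfl⟩
    rw [← sub_add_sub_cancel _ (e T).det, h3]
    exact Ideal.add_mem _ (Ideal.span_mono (Set.image_mono (Set.subset_univ _)) h4) ih

/-- If the radical of `(f)` contains all the variables and `f = a x`, then `det a ∉ (f)`: a matrix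
`b` with `b f = (Xᵢ ^ N)` satisfies `det b * (f) ⊆ (Xᵢ ^ N)`, while
`det b * det a ≡ ∏ Xᵢ ^ (N - 1)` does not vanish modulo `(Xᵢ ^ N)`. -/
theorem det_notMem_span_range [Fintype ι] [DecidableEq ι] [Nontrivial R]
    (f : ι → MvPolynomial ι R)
    (hf : ∀ i, ∃ N, (X i : MvPolynomial ι R) ^ N ∈ Ideal.span (Set.range f))
    (a : Matrix ι ι (MvPolynomial ι R)) (ha : ∀ i, f i = ∑ j, a i j * X j) :
    a.det ∉ Ideal.span (Set.range f) := by
  choose M hM using hf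
  set N := ∑ i, M i
  have hN : ∀ i, (X i : MvPolynomial ι R) ^ (N + 1) ∈ Ideal.span (Set.range f) := fun i =>
    Ideal.pow_mem_of_pow_mem _ (hM i)
      ((Finset.single_le_sum (fun _ _ => Nat.zero_le _) (Finset.mem_univ i)).trans (Nat.le_succ _))
  choose b hb using fun i => Ideal.mem_span_range_iff_exists_fun.1 (hN i)
  intro h
  obtain ⟨c, hc⟩ := Ideal.mem_span_range_iff_exists_fun.1 h
  set J := Ideal.span ((fun i => (X i : MvPolynomial ι R) ^ (N + 1)) '' Set.univ)
  have h1 : (Matrix.of b).det * a.det ∈ J := by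
    rw [← hc, Finset.mul_sum]
    refine J.sum_mem fun i _ => ?_
    rw [mul_left_comm]
    refine J.mul_mem_left _ (det_mul_mem_of_forall_sum_mem J _ f (fun k => ?_) i)
    simp only [Matrix.of_apply, hb]
    exact Ideal.subset_span ⟨k, trivial, rfl⟩
  have h2 := det_sub_det_mem_span_X_pow (N + 1) (Matrix.of b * a)
    (Matrix.diagonal fun i => (X i : MvPolynomial ι R) ^ N)
    (fun i => by
      rw [← hb i]
      simp only [Matrix.mul_apply, Matrix.of_apply, ha, Finset.sum_mul, Finset.mul_sum, mul_assoc]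
      exact Finset.sum_comm)
    (fun i => by simp [Matrix.diagonal_apply, pow_succ])
  rw [Matrix.det_mul, Matrix.det_diagonal] at h2
  exact prod_X_pow_notMem_span N
    (sub_add_cancel (∏ i, (X i : MvPolynomial ι R) ^ N) _ ▸ J.add_mem h2 h1)

end Monomial

/-! ### The Bezoutian and nondegenerate functionals -/

section Bezoutian

variable {K : Type*} [Field K]

theorem exists_aeval_sub_aeval_eq_sum {ι T : Type*} [Fintype ι] [CommRing T] [Algebra K T]
    (u v : ι → T) (p : MvPolynomial ι K) :
    ∃ c : ι → T, ∑ j, c j * (u j - v j) = aeval u p - aeval v p := by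
  rw [← Ideal.mem_span_range_iff_exists_fun, ← Ideal.Quotient.eq]
  set J := Ideal.span (Set.range fun j => u j - v j)
  have : (Ideal.Quotient.mkₐ K J).comp (aeval u) = (Ideal.Quotient.mkₐ K J).comp (aeval v) := by
    refine MvPolynomial.algHom_ext fun j => ?_
    simp only [AlgHom.comp_apply, aeval_X, Ideal.Quotient.mkₐ_eq_mk]
    exact Ideal.Quotient.eq.2 (Ideal.subset_span ⟨j, rfl⟩)
  exact DFunLike.congr_fun this p

theorem exists_linearMap_eq_one {W : Type*} [AddCommGroup W] [Module K W] {z : W} (hz : z ≠ 0) :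
    ∃ φ : W →ₗ[K] K, φ z = 1 := by
  obtain ⟨φ, hφ⟩ := not_forall.1 fun h => hz ((Module.forall_dual_apply_eq_zero_iff K _).1 h)
  exact ⟨(φ z)⁻¹ • φ, inv_mul_cancel₀ hφ⟩

section Contract

variable {Q : Type*} [CommRing Q] [Algebra K Q]

/-- Contraction of the first tensor factor with a linear functional, `a ⊗ b ↦ φ(a) b`. -/
def contractLeft (φ : Q →ₗ[K] K) : Q ⊗[K] Q →ₗ[K] Q :=
  (TensorProduct.lid K Q).toLinearMap ∘ₗ φ.rTensor Q

@[simp]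
theorem contractLeft_tmul (φ : Q →ₗ[K] K) (a b : Q) : contractLeft φ (a ⊗ₜ b) = φ a • b := by
  simp [contractLeft]

theorem contractLeft_one_tmul_mul (φ : Q →ₗ[K] K) (g : Q) (t : Q ⊗[K] Q) :
    contractLeft φ ((1 ⊗ₜ g) * t) = g * contractLeft φ t := by
  induction t using TensorProduct.induction_on with
  | zero => simp
  | tmul a b => simp
  | add s t hs ht => simp only [mul_add, map_add, hs, ht]

theorem contractLeft_tmul_one_mul {φ : Q →ₗ[K] K} {g : Q} (h : ∀ w, φ (g * w) = 0)
    (t : Q ⊗[K] Q) : contractLeft φ ((g ⊗ₜ 1) * t) = 0 := by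
  induction t using TensorProduct.induction_on with
  | zero => simp
  | tmul a b => simp [h]
  | add s t hs ht => simp only [mul_add, map_add, hs, ht, add_zero]

theorem augmentation_contractLeft (φ : Q →ₗ[K] K) (ε : Q →ₐ[K] K) (t : Q ⊗[K] Q) :
    ε (contractLeft φ t) = φ (Algebra.TensorProduct.lift (AlgHom.id K Q)
      ((Algebra.ofId K Q).comp ε) (fun _ _ => Commute.all _ _) t) := by
  induction t using TensorProduct.induction_on with
  | zero => simp
  | tmul a b => simp [Algebra.ofId_apply, Algebra.algebraMap_eq_smul_one, mul_comm]
  | add s t hs ht => simp only [map_add, hs, ht]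

end Contract

/-- `Q` is the quotient of a polynomial ring by the ideal generated by `f`, and is local with the
origin as its only point: the variables are nilpotent in `Q`. -/
structure IsLocalPresentation {ι Q : Type*} [CommRing Q] [Algebra K Q]
    (f : ι → MvPolynomial ι K) (q : MvPolynomial ι K →ₐ[K] Q) : Prop where
  surjective : Function.Surjective q
  eq_zero_iff : ∀ p, q p = 0 ↔ p ∈ Ideal.span (Set.range f)
  nilpotent : ∀ i, IsNilpotent (q (X i))
  map_origin : ∀ i, constantCoeff (f i) = 0

namespace IsLocalPresentation

variable {ι Q : Type*} [CommRing Q] [Algebra K Q]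
  {f : ι → MvPolynomial ι K} {q : MvPolynomial ι K →ₐ[K] Q} (hq : IsLocalPresentation f q)

include hq

theorem exists_augmentation : ∃ ε : Q →ₐ[K] K, ∀ p, ε (q p) = constantCoeff p := by
  have hle : Ideal.span (Set.range f) ≤ RingHom.ker (constantCoeff : MvPolynomial ι K →+* K) :=
    Ideal.span_le.2 (by rintro _ ⟨i, rfl⟩; exact hq.map_origin i)
  let e0 : MvPolynomial ι K →ₐ[K] K := aeval fun _ => 0
  have he0 : ∀ p, e0 p = constantCoeff p := fun p => by simp [e0, aeval_zero']
  refine ⟨AlgHom.liftOfSurjective q hq.surjective e0 fun p hp => ?_, fun p => ?_⟩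
  · change e0 p = 0
    rw [he0]
    exact hle ((hq.eq_zero_iff p).1 hp)
  · rw [← he0]
    exact AlgHom.liftOfSurjective_apply ..

theorem isNilpotent_of_constantCoeff_eq_zero {p : MvPolynomial ι K} (hp : constantCoeff p = 0) :
    IsNilpotent (q p) := by
  have : Ideal.span (Set.range X) ≤ (nilradical Q).comap q :=
    Ideal.span_le.2 (by rintro _ ⟨i, rfl⟩; exact hq.nilpotent i)
  have hp' : p ∈ Ideal.span (Set.range (X : ι → MvPolynomial ι K)) := by
    rw [← Set.image_univ, mem_ideal_span_X_image]
    intro m hm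
    by_contra! h
    have : m = 0 := by ext i; simpa using h i trivial
    rw [this] at hm
    exact (mem_support_iff.1 hm) hp
  exact this hp'

theorem isNilpotent_of_augmentation_eq_zero {ε : Q →ₐ[K] K}
    (hε : ∀ p, ε (q p) = constantCoeff p) {z : Q} (hz : ε z = 0) : IsNilpotent z := by
  obtain ⟨p, rfl⟩ := hq.surjective z
  exact hq.isNilpotent_of_constantCoeff_eq_zero (hε p ▸ hz)

theorem isUnit_of_augmentation_ne_zero {ε : Q →ₐ[K] K}
    (hε : ∀ p, ε (q p) = constantCoeff p) {z : Q} (hz : ε z ≠ 0) : IsUnit z := by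
  have h := hq.isNilpotent_of_augmentation_eq_zero hε
    (z := z - algebraMap K Q (ε z)) (by simp)
  have hu : IsUnit (algebraMap K Q (ε z)) := (IsUnit.mk0 _ hz).map _
  simpa using h.isUnit_add_left_of_commute hu (Commute.all _ _)

theorem finite [Finite ι] : Module.Finite K Q := by
  have hft : Algebra.FiniteType K Q := Algebra.FiniteType.of_surjective q hq.surjective
  have hint : Algebra.IsIntegral K Q := by
    refine ⟨fun z => ?_⟩
    obtain ⟨ε, hε⟩ := hq.exists_augmentation
    have h := hq.isNilpotent_of_augmentation_eq_zero hε
      (z := z - algebraMap K Q (ε z)) (by simp)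
    have h1 : IsIntegral K (z - algebraMap K Q (ε z)) := by
      obtain ⟨N, hN⟩ := h
      exact ⟨Polynomial.X ^ N, Polynomial.monic_X_pow N, by simp [hN]⟩
    simpa using h1.add (isIntegral_algebraMap (x := ε z))
  exact Algebra.IsIntegral.finite

/-- `Q` acts on its socle through the residue field `K`. -/
theorem mul_eq_augmentation_smul {ε : Q →ₐ[K] K} (hε : ∀ p, ε (q p) = constantCoeff p) {e : Q}
    (he : ∀ j, e * q (X j) = 0) (w : Q) : e * w = ε w • e := by
  obtain ⟨p, rfl⟩ := hq.surjective w
  rw [hε]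
  induction p using MvPolynomial.induction_on with
  | C r =>
    have : q (C r) = algebraMap K Q r := q.commutes r
    simp [this, Algebra.smul_def, mul_comm]
  | add p p' h h' => simp [mul_add, h, h', add_smul]
  | mul_X p j _ => simp [mul_left_comm e, he]

variable [Fintype ι] [DecidableEq ι]

theorem map_det_ne_zero (a : Matrix ι ι (MvPolynomial ι K)) (ha : ∀ i, f i = ∑ j, a i j * X j) :
    q a.det ≠ 0 := by
  rw [Ne, hq.eq_zero_iff]
  refine det_notMem_span_range f (fun i => ?_) a ha
  obtain ⟨N, hN⟩ := hq.nilpotent i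
  exact ⟨N, (hq.eq_zero_iff _).1 (by rw [map_pow, hN])⟩

theorem map_det_mul_map_X (a : Matrix ι ι (MvPolynomial ι K)) (ha : ∀ i, f i = ∑ j, a i j * X j)
    (j : ι) : q a.det * q (X j) = 0 := by
  rw [← map_mul, hq.eq_zero_iff]
  exact det_mul_mem_of_forall_sum_mem _ a X
    (fun i => by rw [← ha i]; exact Ideal.subset_span ⟨i, rfl⟩) j

/-- The Bezoutian `B ∈ Q ⊗ Q` is the determinant of a matrix `c` with
`fᵢ ⊗ 1 - 1 ⊗ fᵢ = ∑ⱼ cᵢⱼ (xⱼ ⊗ 1 - 1 ⊗ xⱼ)`. It satisfies `(g ⊗ 1) B = (1 ⊗ g) B` for `g ∈ Q`, and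
restricts to a socle element `E ≠ 0` of `Q` along `x ⊗ 1 ↦ x`, `1 ⊗ x ↦ 0`. If `φ(E) = 1`, then
`u = (φ ⊗ 1)(B)` is a unit. If moreover `φ` vanishes on `gQ`, then
`g u = (φ ⊗ 1)((g ⊗ 1) B) = 0`, so `g = 0`. -/
theorem exists_nondegenerate :
    ∃ φ : Q →ₗ[K] K, ∀ g, (∀ w, φ (g * w) = 0) → g = 0 := by
  obtain ⟨ε, hε⟩ := hq.exists_augmentation
  let l : MvPolynomial ι K →ₐ[K] (MvPolynomial ι K ⊗[K] MvPolynomial ι K) :=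
    Algebra.TensorProduct.includeLeft
  let r : MvPolynomial ι K →ₐ[K] (MvPolynomial ι K ⊗[K] MvPolynomial ι K) :=
    Algebra.TensorProduct.includeRight
  have hdiff : ∀ p : MvPolynomial ι K,
      ∃ c : ι → (MvPolynomial ι K ⊗[K] MvPolynomial ι K),
        ∑ j, c j * (l (X j) - r (X j)) = l p - r p := by
    intro p
    obtain ⟨c, hc⟩ := exists_aeval_sub_aeval_eq_sum (fun j => l (X j)) (fun j => r (X j)) p
    have h1 : aeval (fun j => l (X j)) = l := (MvPolynomial.algHom_ext fun j => by simp)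
    have h2 : aeval (fun j => r (X j)) = r := (MvPolynomial.algHom_ext fun j => by simp)
    exact ⟨c, by rw [hc, h1, h2]⟩
  choose c hc using fun i => hdiff (f i)
  let c' : Matrix ι ι (MvPolynomial ι K ⊗[K] MvPolynomial ι K) := Matrix.of c
  -- restriction to the first factor, at the origin of the second factor
  let ev : (MvPolynomial ι K ⊗[K] MvPolynomial ι K) →ₐ[K] MvPolynomial ι K :=
    Algebra.TensorProduct.lift (AlgHom.id K _)
      ((Algebra.ofId K _).comp (aeval fun _ => 0)) (fun _ _ => Commute.all _ _)
  have hevl : ∀ p, ev (l p) = p := fun p => by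
    change ev (p ⊗ₜ 1) = p
    simp [ev]
  have hevr : ∀ p, ev (r p) = C (constantCoeff p) := fun p => by
    change ev (1 ⊗ₜ p) = _
    simp [ev, Algebra.ofId_apply, MvPolynomial.algebraMap_eq]
  let a : Matrix ι ι (MvPolynomial ι K) := ev.mapMatrix c'
  have ha : ∀ i, f i = ∑ j, a i j * X j := fun i => by
    have := congrArg ev (hc i)
    simpa [hevl, hevr, hq.map_origin, a, c'] using this.symm
  obtain ⟨φ, hφ⟩ := exists_linearMap_eq_one (K := K) (hq.map_det_ne_zero a ha)
  let qq : (MvPolynomial ι K ⊗[K] MvPolynomial ι K) →ₐ[K] Q ⊗[K] Q :=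
    Algebra.TensorProduct.map q q
  have hqq : ∀ p, qq (l p) = q p ⊗ₜ 1 ∧ qq (r p) = 1 ⊗ₜ q p := fun p =>
    ⟨(Algebra.TensorProduct.map_tmul ..).trans (by rw [map_one]),
      (Algebra.TensorProduct.map_tmul ..).trans (by rw [map_one])⟩
  have hcr : ∀ j, c'.det * (l (X j) - r (X j)) ∈ RingHom.ker qq := by
    refine det_mul_mem_of_forall_sum_mem _ c' _ fun i => ?_
    have h0 : q (f i) = 0 := (hq.eq_zero_iff _).2 (Ideal.subset_span ⟨i, rfl⟩)
    simp only [c', Matrix.of_apply, hc i, RingHom.mem_ker]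
    rw [map_sub, (hqq _).1, (hqq _).2, h0, zero_tmul, tmul_zero, sub_zero]
  have hB : ∀ g : Q, (g ⊗ₜ[K] 1) * qq c'.det = (1 ⊗ₜ[K] g) * qq c'.det := by
    intro g
    obtain ⟨p, rfl⟩ := hq.surjective g
    obtain ⟨d, hd⟩ := hdiff p
    rw [← sub_eq_zero, ← sub_mul, ← (hqq p).1, ← (hqq p).2, ← map_sub, ← map_mul, ← hd,
      Finset.sum_mul, map_sum]
    refine Finset.sum_eq_zero fun j _ => ?_
    rw [mul_assoc, mul_comm _ c'.det, map_mul, RingHom.mem_ker.1 (hcr j), mul_zero]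
  have hu : IsUnit (contractLeft φ (qq c'.det)) := by
    refine hq.isUnit_of_augmentation_ne_zero hε ?_
    have hcomp : (Algebra.TensorProduct.lift (AlgHom.id K Q)
      ((Algebra.ofId K Q).comp ε) (fun _ _ => Commute.all _ _)).comp qq = q.comp ev := by
      refine Algebra.TensorProduct.ext' fun p p' => ?_
      simp [qq, ev, hε, Algebra.ofId_apply]
    rw [augmentation_contractLeft]
    have := DFunLike.congr_fun hcomp c'.det
    simp only [AlgHom.comp_apply] at this
    rw [this, AlgHom.map_det, hφ]
    exact one_ne_zero
  refine ⟨φ, fun g hg => ?_⟩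
  have := contractLeft_tmul_one_mul hg (qq c'.det)
  rw [hB, contractLeft_one_tmul_mul] at this
  exact hu.mul_left_eq_zero.1 this

/-- A linear functional with `φ(E) = 1` on the socle element `E` of `Q` has nondegenerate form: a
nonzero ideal of `Q` contains a nonzero socle element, and the socle is one-dimensional because `Q`
carries some nondegenerate functional. -/
theorem eq_zero_of_forall_mul (a : Matrix ι ι (MvPolynomial ι K))
    (ha : ∀ i, f i = ∑ j, a i j * X j) {φ : Q →ₗ[K] K} (hφ : φ (q a.det) = 1) {g : Q}
    (hg : ∀ w, φ (g * w) = 0) : g = 0 := by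
  obtain ⟨ε, hε⟩ := hq.exists_augmentation
  obtain ⟨ψ, hψ⟩ := hq.exists_nondegenerate
  by_contra hg0
  -- descend to a nonzero multiple of `g` in the socle, one variable at a time
  have hsocle : ∀ s : Finset ι, ∃ w, g * w ≠ 0 ∧ ∀ j ∈ s, g * w * q (X j) = 0 := by
    intro s
    induction s using Finset.induction_on with
    | empty => exact ⟨1, by simpa using hg0, by simp⟩
    | insert i s _ ih =>
      obtain ⟨w, hw, hs⟩ := ih
      have hex : ∃ N, g * w * q (X i) ^ N = 0 := by
        obtain ⟨N, hN⟩ := hq.nilpotent i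
        exact ⟨N, by rw [hN, mul_zero]⟩
      classical
      have hpos : Nat.find hex ≠ 0 := fun h0 => hw (by simpa [h0] using Nat.find_spec hex)
      obtain ⟨N, hN⟩ := Nat.exists_eq_succ_of_ne_zero hpos
      refine ⟨w * q (X i) ^ N, ?_, fun j hj => ?_⟩
      · rw [← mul_assoc]
        exact Nat.find_min hex (by omega)
      · rcases Finset.mem_insert.1 hj with rfl | hj
        · have := Nat.find_spec hex
          rw [hN] at this
          rw [← this, pow_succ]; ring
        · rw [← mul_assoc, mul_right_comm, hs j hj, zero_mul]
  obtain ⟨w, hw, hs⟩ := hsocle Finset.univ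
  have hs' := hq.mul_eq_augmentation_smul hε fun j => hs j (Finset.mem_univ j)
  have hE := hq.mul_eq_augmentation_smul hε (hq.map_det_mul_map_X a ha)
  have hψE : ψ (q a.det) ≠ 0 := by
    intro h0
    exact hq.map_det_ne_zero a ha (hψ _ fun w => by rw [hE, map_smul, h0, smul_zero])
  have hdiff : ψ (q a.det) • (g * w) - ψ (g * w) • q a.det = 0 := by
    refine hψ _ fun v => ?_
    rw [sub_mul, smul_mul_assoc, smul_mul_assoc, hs', hE]
    simp only [map_sub, map_smul, smul_eq_mul]
    ring
  have h1 : ψ (g * w) = 0 := by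
    have := congrArg φ hdiff
    simpa [hφ, hg] using this
  rw [h1, zero_smul, sub_zero] at hdiff
  exact (smul_ne_zero hψE hw) hdiff

end IsLocalPresentation

end Bezoutian

/-! ### Hyperbolic forms in the Grothendieck–Witt group -/

section Hyperbolic

variable {K : Type u} [Field K] {V : Type u} [AddCommGroup V] [Module K V]
  {W : Type u} [AddCommGroup W] [Module K W]

theorem GW.mk_congr [Module.Finite K V] [Module.Finite K W] {B : LinearMap.BilinForm K V}
    {B' : LinearMap.BilinForm K W} (hs : B.IsSymm)
    (hn : B.Nondegenerate) (hs' : B'.IsSymm) (hn' : B'.Nondegenerate) (e : V ≃ₗ[K] W)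
    (he : ∀ x y, B' (e x) (e y) = B x y) : GW.mk B hs hn = GW.mk B' hs' hn' :=
  congrArg (Algebra.GrothendieckAddGroup.of (M := IsometryClass K))
    (Quotient.sound (s := SymBilinSpace.setoid) (a := ⟨V, B, hs, hn⟩) (b := ⟨W, B', hs', hn'⟩)
      (show B.Equivalent B' from ⟨{ e with map_app' := he }⟩))

theorem nondegenerate_of_isSymm {B : LinearMap.BilinForm K V} (hs : B.IsSymm)
    (h : ∀ x, (∀ y, B x y = 0) → x = 0) : B.Nondegenerate :=
  ⟨h, fun y hy => h y fun x => by rw [hs.eq]; exact hy x⟩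

theorem directSumForm_isSymm {B : LinearMap.BilinForm K V} {B' : LinearMap.BilinForm K W}
    (hs : B.IsSymm) (hs' : B'.IsSymm) : (directSumForm B B').IsSymm :=
  ⟨fun x y => by simp only [directSumForm_apply]; rw [hs.eq, hs'.eq]⟩

theorem directSumForm_nondegenerate [Module.Finite K V] [Module.Finite K W]
    {B : LinearMap.BilinForm K V} {B' : LinearMap.BilinForm K W}
    (hs : B.IsSymm) (hs' : B'.IsSymm) (hn : B.Nondegenerate) (hn' : B'.Nondegenerate) :
    (directSumForm B B').Nondegenerate :=
  (SymBilinSpace.sum ⟨V, B, hs, hn⟩ ⟨W, B', hs', hn'⟩).nondegenerate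

theorem GW.mk_directSumForm [Module.Finite K V] [Module.Finite K W]
    {B : LinearMap.BilinForm K V} {B' : LinearMap.BilinForm K W}
    (hs : B.IsSymm) (hs' : B'.IsSymm) (hn : B.Nondegenerate) (hn' : B'.Nondegenerate) :
    GW.mk (directSumForm B B') (directSumForm_isSymm hs hs')
      (directSumForm_nondegenerate hs hs' hn hn') = GW.mk B hs hn + GW.mk B' hs' hn' :=
  (Algebra.GrothendieckAddGroup.of (M := IsometryClass K)).map_add
    (Quotient.mk SymBilinSpace.setoid ⟨V, B, hs, hn⟩ : IsometryClass K)
    (Quotient.mk SymBilinSpace.setoid ⟨W, B', hs', hn'⟩)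

/-- The orthogonal direct sum of `k` copies of a bilinear form. -/
def piForm (k : ℕ) (B : LinearMap.BilinForm K V) : LinearMap.BilinForm K (Fin k → V) :=
  ∑ i, B.compl₁₂ (LinearMap.proj i) (LinearMap.proj i)

@[simp]
theorem piForm_apply (k : ℕ) (B : LinearMap.BilinForm K V) (x y : Fin k → V) :
    piForm k B x y = ∑ i, B (x i) (y i) := by
  simp [piForm, LinearMap.sum_apply]

theorem piForm_isSymm (k : ℕ) {B : LinearMap.BilinForm K V} (hs : B.IsSymm) :
    (piForm k B).IsSymm :=
  ⟨fun x y => by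
    simp only [piForm_apply]
    exact Finset.sum_congr rfl fun i _ => hs.eq _ _⟩

theorem piForm_nondegenerate (k : ℕ) {B : LinearMap.BilinForm K V} (hs : B.IsSymm)
    (hn : B.Nondegenerate) : (piForm k B).Nondegenerate := by
  refine nondegenerate_of_isSymm (piForm_isSymm k hs) fun x hx => funext fun i => ?_
  refine hn.1 _ fun v => ?_
  have := hx (Pi.single i v)
  rw [piForm_apply, Finset.sum_eq_single i (fun j _ hj => by simp [hj]) (by simp)] at this
  simpa using this

theorem GW.mk_piForm [Module.Finite K V] (k : ℕ) {B : LinearMap.BilinForm K V} (hs : B.IsSymm)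
    (hn : B.Nondegenerate) :
    GW.mk (piForm k B) (piForm_isSymm k hs) (piForm_nondegenerate k hs hn) =
      k • GW.mk B hs hn := by
  induction k with
  | zero =>
    rw [zero_smul]
    refine Eq.trans ?_ (Algebra.GrothendieckAddGroup.of (M := IsometryClass K)).map_zero
    exact GW.mk_congr _ _ SymBilinSpace.zero.isSymm SymBilinSpace.zero.nondegenerate
      (LinearEquiv.ofSubsingleton (Fin 0 → V) PUnit.{u + 1}) fun x y => (piForm_apply 0 B x y).symm
  | succ k ih =>
    rw [succ_nsmul', ← ih, ← GW.mk_directSumForm hs (piForm_isSymm k hs) hn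
      (piForm_nondegenerate k hs hn)]
    refine (GW.mk_congr _ _ _ _ (Fin.consLinearEquiv K fun _ : Fin (k + 1) => V) fun x y => ?_).symm
    simp [Fin.sum_univ_succ]

/-- The hyperbolic plane `(x, y) ↦ x₁ y₁ - x₂ y₂`. -/
def hyperbolicForm (K : Type u) [Field K] : LinearMap.BilinForm K (K × K) :=
  directSumForm (rankOneForm 1) (rankOneForm (-1))

theorem rankOneForm_isSymm (c : Kˣ) : (rankOneForm c).IsSymm :=
  ⟨fun x y => by simp [mul_comm x y]⟩

theorem rankOneForm_nondegenerate (c : Kˣ) : (rankOneForm c).Nondegenerate :=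
  ⟨fun x hx => by simpa using hx 1, fun y hy => by simpa using hy 1⟩

theorem hyperbolicForm_isSymm : (hyperbolicForm K).IsSymm :=
  directSumForm_isSymm (rankOneForm_isSymm 1) (rankOneForm_isSymm (-1))

theorem hyperbolicForm_nondegenerate : (hyperbolicForm K).Nondegenerate :=
  directSumForm_nondegenerate (rankOneForm_isSymm 1) (rankOneForm_isSymm (-1))
    (rankOneForm_nondegenerate 1) (rankOneForm_nondegenerate (-1))

theorem GW.mk_hyperbolicForm :
    GW.mk (hyperbolicForm K) hyperbolicForm_isSymm hyperbolicForm_nondegenerate =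
      GW.unit 1 + GW.unit (-1) :=
  GW.mk_directSumForm (rankOneForm_isSymm 1) (rankOneForm_isSymm (-1))
    (rankOneForm_nondegenerate 1) (rankOneForm_nondegenerate (-1))

/-- Dual bases `e`, `e'` of two complementary totally isotropic subspaces give the orthogonal basis
`e + e' / 2`, `e - e' / 2`, on which the form takes the values `1` and `-1`. -/
theorem GW.mk_eq_nsmul_of_dual_families [Module.Finite K V] (h2 : (2 : K) ≠ 0)
    {B : LinearMap.BilinForm K V}
    (hs : B.IsSymm) (hn : B.Nondegenerate) (k : ℕ) (hk : Module.finrank K V = 2 * k)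
    (e e' : Fin k → V) (he : ∀ i j, B (e i) (e j) = 0) (he' : ∀ i j, B (e' i) (e' j) = 0)
    (hee' : ∀ i j, B (e i) (e' j) = if i = j then 1 else 0) :
    GW.mk B hs hn = k • (GW.unit (1 : Kˣ) + GW.unit (-1 : Kˣ)) := by
  have he'e : ∀ i j, B (e' i) (e j) = if i = j then 1 else 0 := fun i j => by
    rw [hs.eq (e j) (e' i) |>.symm, hee']
    simp [eq_comm]
  let F : (Fin k → K × K) →ₗ[K] V :=
    ∑ i, ((LinearMap.fst K K K ∘ₗ LinearMap.proj i).smulRight (e i + (2 : K)⁻¹ • e' i) +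
      (LinearMap.snd K K K ∘ₗ LinearMap.proj i).smulRight (e i - (2 : K)⁻¹ • e' i))
  have hF : ∀ x, F x = ∑ i, ((x i).1 • (e i + (2 : K)⁻¹ • e' i) +
      (x i).2 • (e i - (2 : K)⁻¹ • e' i)) := fun x => by simp [F, LinearMap.sum_apply]
  have hhalf : (2 : K)⁻¹ + 2⁻¹ = 1 := by field_simp; norm_num
  have hform : ∀ x y, B (F x) (F y) = piForm k (hyperbolicForm K) x y := by
    intro x y
    rw [piForm_apply, hF, hF, LinearMap.BilinForm.sum_left]
    refine Finset.sum_congr rfl fun i _ => ?_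
    rw [LinearMap.BilinForm.sum_right, Finset.sum_eq_single i]
    · simp only [map_add, map_sub, map_smul, LinearMap.add_apply, LinearMap.sub_apply,
        LinearMap.smul_apply, smul_eq_mul, he, he', hee', he'e, hyperbolicForm, directSumForm_apply,
        rankOneForm_apply, if_true, Units.val_one, Units.val_neg]
      linear_combination ((x i).1 * (y i).1 - (x i).2 * (y i).2) * hhalf
    · intro j _ hj
      simp [he, he', hee', he'e, hj.symm]
    · simp
  have hinj : Function.Injective F := by
    refine (injective_iff_map_eq_zero F).2 fun x hx => ?_
    refine (piForm_nondegenerate k hyperbolicForm_isSymm hyperbolicForm_nondegenerate).1 x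
      fun y => ?_
    rw [← hform, hx, map_zero, LinearMap.zero_apply]
  let E : (Fin k → K × K) ≃ₗ[K] V := LinearEquiv.ofInjectiveOfFinrankEq F hinj (by
    rw [hk, Module.finrank_pi_fintype]; simp [mul_comm])
  rw [← GW.mk_hyperbolicForm, ← GW.mk_piForm k hyperbolicForm_isSymm hyperbolicForm_nondegenerate]
  exact (GW.mk_congr _ _ _ _ E fun x y => hform x y).symm

/-- A nondegenerate symmetric form on the sum of two totally isotropic subspaces is hyperbolic. -/
theorem GW.mk_eq_nsmul_of_isotropic [Module.Finite K V] (h2 : (2 : K) ≠ 0)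
    {B : LinearMap.BilinForm K V}
    (hs : B.IsSymm) (hn : B.Nondegenerate) (P M : Submodule K V) (hPM : IsCompl P M)
    (hP : ∀ x ∈ P, ∀ y ∈ P, B x y = 0) (hM : ∀ x ∈ M, ∀ y ∈ M, B x y = 0) :
    Even (Module.finrank K V) ∧ GW.mk B hs hn =
      (Module.finrank K V / 2) • (GW.unit (1 : Kˣ) + GW.unit (-1 : Kˣ)) := by
  have key : ∀ P M : Submodule K V, IsCompl P M → (∀ x ∈ M, ∀ y ∈ M, B x y = 0) →
      Function.Injective ((B.domRestrict₁₂ M P : M →ₗ[K] Module.Dual K P)) := by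
    intro P M hPM hM
    refine (injective_iff_map_eq_zero _).2 fun m hm => ?_
    refine Subtype.ext (hn.1 _ fun y => ?_)
    obtain ⟨p, m', hp, hm', rfl⟩ := Submodule.codisjoint_iff_exists_add_eq.1 hPM.codisjoint y
    rw [map_add, hM _ m.2 _ hm', add_zero]
    exact LinearMap.congr_fun hm ⟨p, hp⟩
  have hinj := key P M hPM hM
  have h1 := LinearMap.finrank_le_finrank_of_injective hinj
  have h2' := LinearMap.finrank_le_finrank_of_injective (key M P hPM.symm hP)
  rw [Subspace.dual_finrank_eq] at h1 h2'
  have hk : Module.finrank K V = 2 * Module.finrank K P := by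
    have := Submodule.finrank_add_eq_of_isCompl hPM
    omega
  have hsurj := (LinearMap.injective_iff_surjective_of_finrank_eq_finrank (by
    rw [Subspace.dual_finrank_eq]; omega)).1 hinj
  let b := Module.finBasis K P
  choose e' he' using fun j => hsurj (b.coord j)
  refine ⟨⟨_, hk.trans (two_mul _)⟩, ?_⟩
  rw [hk, Nat.mul_div_cancel_left _ two_pos]
  refine GW.mk_eq_nsmul_of_dual_families h2 hs hn _ hk (fun i => b i) (fun j => e' j)
    (fun i j => hP _ (b i).2 _ (b j).2) (fun i j => hM _ (e' i).2 _ (e' j).2) fun i j => ?_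
  have := LinearMap.congr_fun (he' j) (b i)
  rw [Module.Basis.coord_apply, Module.Basis.repr_self, Finsupp.single_apply] at this
  rw [← hs.eq]
  exact this

end Hyperbolic

/-! ### An involution which negates the socle -/

theorem exists_sq_eq_of_isNilpotent {Q : Type*} [CommRing Q] (h2 : IsUnit (2 : Q)) {c : Q}
    (hc : IsNilpotent (c - 1)) : ∃ r, r ^ 2 = c := by
  obtain ⟨r, ⟨-, hr⟩, -⟩ := Polynomial.existsUnique_nilpotent_sub_and_aeval_eq_zero
    (P := Polynomial.X ^ 2 - Polynomial.C c) (x := (1 : Q))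
    (by simpa using (isNilpotent_neg_iff.2 hc)) (by simpa [one_add_one_eq_two] using h2)
  exact ⟨r, by simpa [sub_eq_zero] using hr⟩

namespace IsLocalPresentation

variable {K : Type u} [Field K] {ι : Type*} {Q : Type u} [CommRing Q] [Algebra K Q]
  {f : ι → MvPolynomial ι K} {q : MvPolynomial ι K →ₐ[K] Q} (hq : IsLocalPresentation f q)
  [Fintype ι] [DecidableEq ι]

include hq

theorem functionalForm_nondegenerate (a : Matrix ι ι (MvPolynomial ι K))
    (ha : ∀ i, f i = ∑ j, a i j * X j) {φ : Q →ₗ[K] K} (hφ : φ (q a.det) = 1) :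
    (functionalForm φ).Nondegenerate :=
  nondegenerate_of_isSymm (functionalForm_isSymm φ) fun _ hx => hq.eq_zero_of_forall_mul a ha hφ hx

/-- Two functionals `φ`, `ψ` with `φ(E) = ψ(E) = 1` have isometric forms: `φ = ψ(c ·)` with
`c ≡ 1` modulo the maximal ideal, and `c` is a square. -/
theorem mk_functionalForm_eq [Module.Finite K Q] (h2 : (2 : K) ≠ 0)
    (a : Matrix ι ι (MvPolynomial ι K))
    (ha : ∀ i, f i = ∑ j, a i j * X j) {φ ψ : Q →ₗ[K] K} (hφ : φ (q a.det) = 1)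
    (hψ : ψ (q a.det) = 1) :
    GW.mk (functionalForm φ) (functionalForm_isSymm φ) (hq.functionalForm_nondegenerate a ha hφ) =
      GW.mk (functionalForm ψ) (functionalForm_isSymm ψ)
        (hq.functionalForm_nondegenerate a ha hψ) := by
  obtain ⟨ε, hε⟩ := hq.exists_augmentation
  have hsurj : Function.Surjective (functionalForm ψ : Q →ₗ[K] Module.Dual K Q) := by
    refine (LinearMap.injective_iff_surjective_of_finrank_eq_finrank
      Subspace.dual_finrank_eq.symm).1 ((injective_iff_map_eq_zero _).2 fun x hx => ?_)
    exact hq.eq_zero_of_forall_mul a ha hψ fun w => LinearMap.congr_fun hx w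
  obtain ⟨c, hc⟩ := hsurj φ
  have hc' : ∀ z, ψ (c * z) = φ z := fun z => LinearMap.congr_fun hc z
  have hεc : ε c = 1 := by
    have := hc' (q a.det)
    rwa [mul_comm, hq.mul_eq_augmentation_smul hε (hq.map_det_mul_map_X a ha), map_smul, hψ, hφ,
      smul_eq_mul, mul_one] at this
  obtain ⟨r, rfl⟩ := exists_sq_eq_of_isNilpotent (Q := Q)
    (by simpa only [map_ofNat] using (IsUnit.mk0 _ h2).map (algebraMap K Q))
    (hq.isNilpotent_of_augmentation_eq_zero hε (z := c - 1) (by simp [hεc]))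
  have hr : IsUnit r := by
    refine hq.isUnit_of_augmentation_ne_zero hε fun h0 => ?_
    simp [h0] at hεc
  refine GW.mk_congr _ _ _ _ (LinearEquiv.ofInjectiveEndo (LinearMap.mulLeft K r)
    fun x y hxy => hr.mul_left_cancel hxy) fun x y => ?_
  change ψ (r * x * (r * y)) = φ (x * y)
  rw [← hc']
  congr 1
  ring

/-- For an involution `s` of `Q` with `s(E) = -E`, replace `φ` by `ψ = (φ - φ ∘ s) / 2`. Then `ψ`
vanishes on the `s`-invariants, which contain all products of two invariant and of two
anti-invariant elements, so both eigenspaces of `s` are totally isotropic for `β_ψ`. -/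
theorem mk_functionalForm_eq_nsmul [Module.Finite K Q] (h2 : (2 : K) ≠ 0)
    (s : Q →ₐ[K] Q) (hss : ∀ z, s (s z) = z)
    (hsoc : ∀ e, (∀ j, e * q (X j) = 0) → s e = -e)
    (a : Matrix ι ι (MvPolynomial ι K))
    (ha : ∀ i, f i = ∑ j, a i j * X j) {φ : Q →ₗ[K] K} (hφ : φ (q a.det) = 1) :
    Even (Module.finrank K Q) ∧
    GW.mk (functionalForm φ) (functionalForm_isSymm φ) (hq.functionalForm_nondegenerate a ha hφ) =
      (Module.finrank K Q / 2) • (GW.unit (1 : Kˣ) + GW.unit (-1 : Kˣ)) := by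
  have hhalf : (2 : K)⁻¹ + 2⁻¹ = 1 := by field_simp; norm_num
  let ψ : Q →ₗ[K] K := (2 : K)⁻¹ • (φ - φ ∘ₗ s.toLinearMap)
  have hψ_apply : ∀ z, ψ z = 2⁻¹ * (φ z - φ (s z)) := fun z => rfl
  have hψ : ψ (q a.det) = 1 := by
    rw [hψ_apply, hsoc _ (hq.map_det_mul_map_X a ha), map_neg, hφ]
    linear_combination hhalf
  have hψ0 : ∀ z, s z = z → ψ z = 0 := fun z hz => by rw [hψ_apply, hz, sub_self, mul_zero]
  rw [hq.mk_functionalForm_eq h2 a ha hφ hψ]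
  let P : Submodule K Q := LinearMap.eqLocus s.toLinearMap LinearMap.id
  let M : Submodule K Q := LinearMap.eqLocus s.toLinearMap (-LinearMap.id)
  have hmemP : ∀ z, z ∈ P ↔ s z = z := fun z => Iff.rfl
  have hmemM : ∀ z, z ∈ M ↔ s z = -z := fun z => Iff.rfl
  refine GW.mk_eq_nsmul_of_isotropic h2 _ _ P M ⟨?_, ?_⟩ (fun x hx y hy => hψ0 _ ?_)
    fun x hx y hy => hψ0 _ ?_
  · refine Submodule.disjoint_def.2 fun z hz hz' => ?_
    rw [hmemP] at hz
    rw [hmemM, hz] at hz'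
    have : (2 : K) • z = 0 := by rw [two_smul]; nth_rewrite 1 [hz']; exact neg_add_cancel z
    exact (smul_eq_zero.1 this).resolve_left h2
  · refine Submodule.codisjoint_iff_exists_add_eq.2 fun z =>
      ⟨(2 : K)⁻¹ • (z + s z), (2 : K)⁻¹ • (z - s z), ?_, ?_, ?_⟩
    · rw [hmemP, map_smul, map_add, hss, add_comm]
    · rw [hmemM, map_smul, map_sub, hss, ← smul_neg, neg_sub]
    · rw [← smul_add, add_add_sub_cancel, smul_add, ← add_smul, hhalf, one_smul]
  · change s (x * y) = x * y
    rw [map_mul, (hmemP x).1 hx, (hmemP y).1 hy]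
  · change s (x * y) = x * y
    rw [map_mul, (hmemM x).1 hx, (hmemM y).1 hy, neg_mul_neg]

end IsLocalPresentation

/-! ### The local algebra at the origin -/

section LocalAlgebra

variable {K : Type u} [Field K] {n : ℕ}

/-- The quotient map `K[x₁, …, xₙ] → Q(f)` as a homomorphism of `K`-algebras. -/
noncomputable def toLocalAlgebraₐ (f : Fin n → MvPolynomial (Fin n) K) :
    MvPolynomial (Fin n) K →ₐ[K] LocalAlgebra f where
  toRingHom := toLocalAlgebra f
  commutes' _ := rfl

@[simp]
theorem toLocalAlgebraₐ_apply (f : Fin n → MvPolynomial (Fin n) K) (p : MvPolynomial (Fin n) K) :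
    toLocalAlgebraₐ f p = toLocalAlgebra f p := rfl

/-- If the variables are nilpotent modulo `(f)`, then polynomials which do not vanish at the origin
are already units modulo `(f)`, so that localizing at the origin changes nothing. -/
theorem isLocalPresentation_toLocalAlgebraₐ (f : Fin n → MvPolynomial (Fin n) K)
    (hf : ∀ i, ∃ N, (X i : MvPolynomial (Fin n) K) ^ N ∈ Ideal.span (Set.range f))
    (h0 : ∀ i, constantCoeff (f i) = 0) :
    IsLocalPresentation f (toLocalAlgebraₐ f) := by
  set I := Ideal.span (Set.range f)
  have hquot : IsLocalPresentation f (Ideal.Quotient.mkₐ K I) :=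
    { surjective := Ideal.Quotient.mkₐ_surjective K I
      eq_zero_iff := fun p => Ideal.Quotient.eq_zero_iff_mem
      nilpotent := fun i => by
        obtain ⟨N, hN⟩ := hf i
        exact ⟨N, Ideal.Quotient.eq_zero_iff_mem.2 hN⟩
      map_origin := h0 }
  obtain ⟨ε, hε⟩ := hquot.exists_augmentation
  have hinv : ∀ t : MvPolynomial (Fin n) K, t ∉ originIdeal K n → ∃ t', t * t' - 1 ∈ I := by
    intro t ht
    obtain ⟨c, hc⟩ := (hquot.isUnit_of_augmentation_ne_zero hε (z := Ideal.Quotient.mkₐ K I t)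
      (by rw [hε]; exact ht)).exists_right_inv
    obtain ⟨t', rfl⟩ := hquot.surjective c
    exact ⟨t', (hquot.eq_zero_iff _).1 (by rw [map_sub, map_mul, hc, map_one, sub_self])⟩
  let L := Localization.AtPrime (originIdeal K n)
  let al := algebraMap (MvPolynomial (Fin n) K) L
  let J : Ideal L := Ideal.span (Set.range fun i => al (f i))
  have hJ : J = I.map al := by
    rw [Ideal.map_span, ← Set.range_comp]
    rfl
  have hker : ∀ p, toLocalAlgebra f p = 0 ↔ p ∈ I := by
    intro p
    have h1 : toLocalAlgebra f p = 0 ↔ al p ∈ J := Ideal.Quotient.eq_zero_iff_mem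
    rw [h1, hJ]
    refine ⟨fun h => ?_, Ideal.mem_map_of_mem _⟩
    obtain ⟨t, ht, htp⟩ := (IsLocalization.algebraMap_mem_map_algebraMap_iff
      (originIdeal K n).primeCompl L I p).1 h
    obtain ⟨t', ht'⟩ := hinv t ht
    have : p = t' * (t * p) - p * (t * t' - 1) := by ring
    rw [this]
    exact I.sub_mem (I.mul_mem_left _ htp) (I.mul_mem_left _ ht')
  refine ⟨fun z => ?_, hker, fun i => ?_, h0⟩
  · obtain ⟨l, rfl⟩ := Ideal.Quotient.mk_surjective z
    obtain ⟨⟨p, t⟩, hpt⟩ := IsLocalization.surj (originIdeal K n).primeCompl l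
    obtain ⟨t', ht'⟩ := hinv t t.2
    refine ⟨p * t', ?_⟩
    have h1 : toLocalAlgebra f (t * t') = 1 := by
      rw [← sub_eq_zero, ← map_one (toLocalAlgebra f), ← map_sub, hker]
      exact ht'
    have h2 : (id (Ideal.Quotient.mk J l) : LocalAlgebra f) * toLocalAlgebra f t =
        toLocalAlgebra f p :=
      congrArg (Ideal.Quotient.mk J) hpt
    rw [toLocalAlgebraₐ_apply, map_mul, ← h2, mul_assoc, ← map_mul, h1, mul_one]
    rfl
  · obtain ⟨N, hN⟩ := hf i
    exact ⟨N, by rw [toLocalAlgebraₐ_apply, ← map_pow, hker]; exact hN⟩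

theorem exists_sum_mul_X_of_constantCoeff_eq_zero {p : MvPolynomial (Fin n) K}
    (h0 : constantCoeff p = 0) : ∃ c : Fin n → MvPolynomial (Fin n) K, p = ∑ j, c j * X j := by
  obtain ⟨c, hc⟩ := exists_aeval_sub_aeval_eq_sum (K := K)
    (X : Fin n → MvPolynomial (Fin n) K) (fun _ => 0) p
  refine ⟨c, ?_⟩
  simp only [sub_zero] at hc
  rw [hc, aeval_X_left_apply, aeval_zero', h0, map_zero, sub_zero]

/-- A map with components invariant under an involution `τ` which fixes the hypersurface `α = 0`
pointwise and negates `α` has hyperbolic EKL-degree. If `α p ∈ (f)`, then `p + τ p ∈ (f)`: apply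
`τ` to `α p = ∑ cᵢ fᵢ`, subtract, and cancel `α`. So `τ` negates the socle of `Q(f)`. -/
theorem hasEKLDegree_of_involution (h2 : (2 : K) ≠ 0) (f : Fin n → MvPolynomial (Fin n) K)
    (hf : ∀ i, ∃ N, (X i : MvPolynomial (Fin n) K) ^ N ∈ Ideal.span (Set.range f))
    (h0 : ∀ i, constantCoeff (f i) = 0)
    (τ : MvPolynomial (Fin n) K →ₐ[K] MvPolynomial (Fin n) K) (hττ : ∀ p, τ (τ p) = p)
    (hτf : ∀ i, τ (f i) = f i) (α : MvPolynomial (Fin n) K) (hα : α ≠ 0)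
    (hα0 : constantCoeff α = 0) (hτα : τ α = -α) (hdvd : ∀ p, α ∣ p - τ p) :
    Even (localDegree f) ∧
      HasEKLDegree f ((localDegree f / 2) • (GW.unit (1 : Kˣ) + GW.unit (-1 : Kˣ))) := by
  have hq := isLocalPresentation_toLocalAlgebraₐ f hf h0
  set q := toLocalAlgebraₐ f
  obtain ⟨ε, hε⟩ := hq.exists_augmentation
  have hfin : Module.Finite K (LocalAlgebra f) := hq.finite
  have hτI : ∀ p ∈ Ideal.span (Set.range f), τ p ∈ Ideal.span (Set.range f) := by
    intro p hp
    have : Ideal.span (Set.range f) ≤ (Ideal.span (Set.range f)).comap τ :=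
      Ideal.span_le.2 (by
        rintro _ ⟨i, rfl⟩
        change τ (f i) ∈ Ideal.span (Set.range f)
        rw [hτf]
        exact Ideal.subset_span ⟨i, rfl⟩)
    exact this hp
  let s : LocalAlgebra f →ₐ[K] LocalAlgebra f :=
    AlgHom.liftOfSurjective q hq.surjective (q.comp τ) fun p hp =>
      (hq.eq_zero_iff _).2 (hτI p ((hq.eq_zero_iff p).1 hp))
  have hs : ∀ p, s (q p) = q (τ p) := fun p => AlgHom.liftOfSurjective_apply ..
  have hss : ∀ z, s (s z) = z := by
    intro z
    obtain ⟨p, rfl⟩ := hq.surjective z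
    rw [hs, hs, hττ]
  have hsoc : ∀ e, (∀ j, e * q (X j) = 0) → s e = -e := by
    intro e he
    have hαe : e * q α = 0 := by
      rw [hq.mul_eq_augmentation_smul hε he, hε, hα0, zero_smul]
    obtain ⟨p, rfl⟩ := hq.surjective e
    rw [← map_mul, hq.eq_zero_iff] at hαe
    obtain ⟨c, hc⟩ := Ideal.mem_span_range_iff_exists_fun.1 hαe
    choose d hd using fun i => hdvd (c i)
    have hτc := congrArg τ hc
    simp only [map_sum, map_mul, hτf, hτα] at hτc
    have hsum : α * (p + τ p) = α * ∑ i, d i * f i := by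
      have : ∑ i, (c i - τ (c i)) * f i = α * (p + τ p) := by
        simp only [sub_mul, Finset.sum_sub_distrib, hc, hτc]
        ring
      rw [← this, Finset.mul_sum]
      exact Finset.sum_congr rfl fun i _ => by rw [hd, mul_assoc]
    rw [hs, eq_neg_iff_add_eq_zero, ← map_add, add_comm, hq.eq_zero_iff, mul_left_cancel₀ hα hsum]
    exact Ideal.mem_span_range_iff_exists_fun.2 ⟨d, rfl⟩
  choose a ha using fun i => exists_sum_mul_X_of_constantCoeff_eq_zero (h0 i)
  obtain ⟨φ, hφ⟩ := exists_linearMap_eq_one (K := K) (hq.map_det_ne_zero a ha)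
  exact ⟨(hq.mk_functionalForm_eq_nsmul h2 s hss hsoc a ha hφ).1,
    { map_origin := h0
      isolated := hfin
      exists_admissible := ⟨a, φ, ha, hφ⟩
      eq_class := fun a φ h => ⟨hq.functionalForm_nondegenerate a h.eq_sum h.map_socle,
        (hq.mk_functionalForm_eq_nsmul h2 s hss hsoc a h.eq_sum h.map_socle).2⟩ }⟩

end LocalAlgebra

/-! ### Polynomial functions and invariants in coordinates -/

section PolyAction

variable {K : Type u} [Field K] {V : Type v} [AddCommGroup V] [Module K V] {G : Type w} [Group G]

theorem polyAction_ι (ρ : Representation K G V) (g : G) (m : Module.Dual K V) :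
    polyAction ρ g (SymmetricAlgebra.ι K _ m) = SymmetricAlgebra.ι K _ (ρ.dual g m) :=
  SymmetricAlgebra.lift_ι_apply _ m

theorem polyFun_algHom_congr {A : Type*} [CommRing A] [Algebra K A] {F F' : PolyFun K V →ₐ[K] A}
    (h : ∀ m, F (SymmetricAlgebra.ι K _ m) = F' (SymmetricAlgebra.ι K _ m)) (p : PolyFun K V) :
    F p = F' p :=
  DFunLike.congr_fun (SymmetricAlgebra.algHom_ext (LinearMap.ext h)) p

theorem polyAction_one (ρ : Representation K G V) (p : PolyFun K V) : polyAction ρ 1 p = p :=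
  polyFun_algHom_congr (F' := AlgHom.id K _) (fun m => by
    rw [polyAction_ι, map_one, Module.End.one_apply, AlgHom.id_apply]) p

theorem polyAction_mul (ρ : Representation K G V) (g h : G) (p : PolyFun K V) :
    polyAction ρ (g * h) p = polyAction ρ g (polyAction ρ h p) :=
  polyFun_algHom_congr (F' := (polyAction ρ g).comp (polyAction ρ h)) (fun m => by
    simp only [AlgHom.comp_apply, polyAction_ι, map_mul, Module.End.mul_apply]) p

theorem originPoint_ι (m : Module.Dual K V) : originPoint K V (SymmetricAlgebra.ι K _ m) = 0 :=
  SymmetricAlgebra.algebraMapInv_ι m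

theorem originPoint_polyAction (ρ : Representation K G V) (g : G) (p : PolyFun K V) :
    originPoint K V (polyAction ρ g p) = originPoint K V p :=
  polyFun_algHom_congr (F := (originPoint K V).comp (polyAction ρ g)) (fun m => by
    rw [AlgHom.comp_apply, polyAction_ι, originPoint_ι, originPoint_ι]) p

/-- The action of `G` on `K[V]` through `polyAction`. -/
abbrev polyMulSemiringAction (ρ : Representation K G V) : MulSemiringAction G (PolyFun K V) where
  smul g p := polyAction ρ g p
  one_smul := polyAction_one ρ
  mul_smul := polyAction_mul ρ
  smul_zero g := map_zero (polyAction ρ g)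
  smul_add g := map_add (polyAction ρ g)
  smul_one g := map_one (polyAction ρ g)
  smul_mul g := map_mul (polyAction ρ g)

theorem isIntegral_invariantRing [Finite G] (ρ : Representation K G V) :
    Algebra.IsIntegral (invariantRing ρ) (PolyFun K V) := by
  let := polyMulSemiringAction ρ
  have : SMulCommClass G (invariantRing ρ) (PolyFun K V) := ⟨fun g r p => by
    change polyAction ρ g (r.1 * p) = r.1 * polyAction ρ g p
    rw [map_mul, r.2 g]⟩
  have : Algebra.IsInvariant (invariantRing ρ) (PolyFun K V) G := ⟨fun p hp => ⟨⟨p, hp⟩, rfl⟩⟩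
  exact Algebra.IsInvariant.isIntegral _ _ G

/-- The orbit polynomial `∏ (T - g p)` has invariant coefficients, and if `p` vanishes at the
origin then so do all of them but the leading one. -/
theorem exists_pow_mem_span_invariants [Finite G] (ρ : Representation K G V) {p : PolyFun K V}
    (hp : originPoint K V p = 0) :
    ∃ N, p ^ N ∈ Ideal.span {r : PolyFun K V | r ∈ invariantRing ρ ∧ originPoint K V r = 0} := by
  let := polyMulSemiringAction ρ
  obtain ⟨_⟩ := nonempty_fintype G
  let P := MulSemiringAction.charpoly G p
  have hmonic : P.Monic := MulSemiringAction.monic_charpoly G p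
  have hmap : P.map (originPoint K V : PolyFun K V →+* K) = Polynomial.X ^ Fintype.card G := by
    simp only [P, MulSemiringAction.charpoly_eq, Polynomial.map_prod, Polynomial.map_sub,
      Polynomial.map_X, Polynomial.map_C]
    have h : ∀ g : G, (originPoint K V : PolyFun K V →+* K) (g • p) = 0 := fun g =>
      (originPoint_polyAction ρ g p).trans hp
    simp [h]
  have hdeg : P.natDegree = Fintype.card G := by
    rw [← hmonic.natDegree_map (originPoint K V : PolyFun K V →+* K), hmap,
      Polynomial.natDegree_X_pow]
  refine ⟨P.natDegree, ?_⟩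
  have heval : P.eval p = 0 := MulSemiringAction.eval_charpoly G p
  rw [Polynomial.eval_eq_sum_range, Finset.sum_range_succ, hmonic.coeff_natDegree, one_mul,
    add_comm] at heval
  rw [eq_neg_of_add_eq_zero_left heval]
  refine neg_mem (Ideal.sum_mem _ fun i hi => Ideal.mul_mem_right _ _ (Ideal.subset_span ⟨?_, ?_⟩))
  · exact fun g => MulSemiringAction.smul_coeff_charpoly p i g
  · have := congrArg (fun R => Polynomial.coeff R i) hmap
    simp only [Polynomial.coeff_map, Polynomial.coeff_X_pow, ← hdeg] at this
    rw [if_neg (Finset.mem_range.1 hi).ne] at this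
    exact this

/-- A reflection in `G` negates some nonzero linear form `α`, and it acts trivially modulo `α`. -/
theorem exists_polyAction_reflection (h2 : (2 : K) ≠ 0) (ρ : Representation K G V) {g : G}
    (hg : IsReflection (ρ g)) :
    (∀ p, polyAction ρ g (polyAction ρ g p) = p) ∧
      ∃ α : PolyFun K V, α ≠ 0 ∧ originPoint K V α = 0 ∧ polyAction ρ g α = -α ∧
        ∀ p, α ∣ p - polyAction ρ g p := by
  obtain ⟨x, l, hlx, hρ⟩ := hg
  have hinv : ∀ v, ρ g⁻¹ v = v - l v • x := by
    intro v
    have h1 : ρ g (v - l v • x) = v := by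
      rw [hρ, ← Module.reflection_apply v hlx]
      exact Module.involutive_reflection hlx v
    conv_lhs => rw [← h1]
    exact Representation.inv_self_apply ρ g _
  have hdual : ∀ m : Module.Dual K V, ρ.dual g m = m - m x • l := by
    intro m
    ext v
    change m (ρ g⁻¹ v) = _
    rw [hinv]
    simp [mul_comm]
  have hι : ∀ m, polyAction ρ g (SymmetricAlgebra.ι K _ m) =
      SymmetricAlgebra.ι K _ m - m x • SymmetricAlgebra.ι K _ l := fun m => by
    rw [polyAction_ι, hdual, map_sub, map_smul]
  have hl : polyAction ρ g (SymmetricAlgebra.ι K _ l) = -SymmetricAlgebra.ι K _ l := by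
    rw [hι, hlx, two_smul]
    abel
  refine ⟨fun p => ?_, SymmetricAlgebra.ι K _ l, fun h0 => h2 ?_,
    originPoint_ι l, hl, fun p => ?_⟩
  · refine polyFun_algHom_congr (F := (polyAction ρ g).comp (polyAction ρ g))
      (F' := AlgHom.id K _) (fun m => ?_) p
    simp only [AlgHom.comp_apply, AlgHom.id_apply, hι, map_sub, map_smul, hlx]
    module
  · -- evaluation at `x` separates the linear form from zero
    have := congrArg (SymmetricAlgebra.lift (Module.Dual.eval K V x)) h0
    rw [SymmetricAlgebra.lift_ι_apply, map_zero] at this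
    rw [← hlx]
    exact this
  · rw [← Ideal.mem_span_singleton, ← Ideal.Quotient.eq]
    set J := Ideal.span {SymmetricAlgebra.ι K (Module.Dual K V) l}
    refine polyFun_algHom_congr (F := Ideal.Quotient.mkₐ K J)
      (F' := (Ideal.Quotient.mkₐ K J).comp (polyAction ρ g)) (fun m => ?_) p
    rw [AlgHom.comp_apply, hι]
    refine Ideal.Quotient.eq.2 ?_
    rw [sub_sub_cancel]
    exact Submodule.smul_of_tower_mem J _ (Ideal.mem_span_singleton_self _)

end PolyAction

section Coordinates

variable {K : Type u} [Field K]

theorem Coordinates.apply_equiv {A : Type*} [CommRing A] [Algebra K A] {ε : A →ₐ[K] K} {n : ℕ}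
    (x : Coordinates ε n) (p : MvPolynomial (Fin n) K) : ε (x.equiv p) = constantCoeff p := by
  have : ε.comp x.equiv.toAlgHom = aeval fun _ => 0 :=
    MvPolynomial.algHom_ext fun i => by simpa using x.origin i
  have := DFunLike.congr_fun this p
  rw [aeval_zero'] at this
  exact this

/-- Polynomial generators can be translated so that they vanish at a given point. -/
theorem nonempty_coordinates {A : Type*} [CommRing A] [Algebra K A] (ε : A →ₐ[K] K) {n : ℕ}
    (e : MvPolynomial (Fin n) K ≃ₐ[K] A) : Nonempty (Coordinates ε n) := by
  let t : (Fin n → K) → MvPolynomial (Fin n) K →ₐ[K] MvPolynomial (Fin n) K :=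
    fun c => aeval fun i => X i + algebraMap K _ (c i)
  have ht : ∀ c, (t c).comp (t (-c)) = AlgHom.id K _ := fun c =>
    MvPolynomial.algHom_ext fun i => by simp [t, -algebraMap_eq]
  let c : Fin n → K := fun i => -ε (e (X i))
  let E : MvPolynomial (Fin n) K ≃ₐ[K] MvPolynomial (Fin n) K :=
    AlgEquiv.ofAlgHom (t c) (t (-c)) (ht c) (by simpa using ht (-c))
  refine ⟨⟨E.trans e, fun i => ?_⟩⟩
  have h : E (X i) = X i + algebraMap K _ (c i) := by simp [E, t, -algebraMap_eq]
  rw [AlgEquiv.trans_apply, h, map_add, map_add, e.commutes, ε.commutes]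
  exact add_neg_cancel _

variable {V : Type v} [AddCommGroup V] [Module K V] [FiniteDimensional K V]

/-- Linear coordinates on `V`. -/
noncomputable def polyFunEquiv (K : Type u) [Field K] (V : Type v) [AddCommGroup V] [Module K V]
    [FiniteDimensional K V] :
    MvPolynomial (Fin (Module.finrank K V)) K ≃ₐ[K] PolyFun K V :=
  (SymmetricAlgebra.equivMvPolynomial
    (Module.finBasisOfFinrankEq K (Module.Dual K V) Subspace.dual_finrank_eq)).symm

variable {G : Type w} [Group G]

/-- The number of polynomial generators of the invariant ring is its transcendence degree over `K`,
which is that of `K[V]`, because `K[V]` is integral over the invariant ring. -/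
theorem nonempty_algEquiv_invariantRing [Finite G] (ρ : Representation K G V) {σ : Type*}
    (e : MvPolynomial σ K ≃ₐ[K] invariantRing ρ) :
    Nonempty (MvPolynomial (Fin (Module.finrank K V)) K ≃ₐ[K] invariantRing ρ) := by
  have hint := isIntegral_invariantRing ρ
  have hinj : FaithfulSMul (invariantRing ρ) (PolyFun K V) :=
    (faithfulSMul_iff_algebraMap_injective _ _).2 Subtype.val_injective
  have hinj' : FaithfulSMul K (invariantRing ρ) :=
    (faithfulSMul_iff_algebraMap_injective _ _).2 (algebraMap K (invariantRing ρ)).injective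
  have h1 : Algebra.trdeg K (invariantRing ρ) = Algebra.trdeg K (PolyFun K V) := by
    rw [← _root_.trdeg_add_eq K (invariantRing ρ) (A := PolyFun K V),
      _root_.trdeg_eq_zero (R := invariantRing ρ),
      add_zero]
  have h2 := (polyFunEquiv K V).lift_trdeg_eq
  have h3 := e.lift_trdeg_eq
  rw [h1] at h3
  rw [MvPolynomial.trdeg_of_isDomain] at h2 h3
  have h4 : Cardinal.mk σ = Module.finrank K V := by
    rw [Cardinal.mk_fin, Cardinal.lift_natCast, Cardinal.lift_natCast, eq_comm,
      Cardinal.lift_eq_nat_iff] at h2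
    rwa [h2, Cardinal.lift_natCast, Cardinal.lift_eq_nat_iff, Cardinal.lift_eq_nat_iff] at h3
  have : Finite σ := Cardinal.mk_lt_aleph0_iff.1 (h4 ▸ Cardinal.natCast_lt_aleph0)
  have h5 : Nat.card σ = Module.finrank K V := by rw [Nat.card, h4, Cardinal.toNat_natCast]
  exact ⟨(renameEquiv K (Finite.equivFinOfCardEq h5).symm).trans e⟩

end Coordinates

end EKL

theorem proposition1p0 {K : Type u} [Field K] (hK : ringChar K ≠ 2)
    {V : Type v} [AddCommGroup V] [Module K V] [FiniteDimensional K V]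
    {G : Type w} [Group G] [Finite G] (ρ : Representation K G V)
    {σ : Type*} (hpoly : Nonempty (MvPolynomial σ K ≃ₐ[K] EKL.invariantRing ρ))
    (hrefl : ∃ g : G, EKL.IsReflection (ρ g)) :
    Nonempty (EKL.Coordinates (EKL.originPoint K V) (Module.finrank K V)) ∧
    Nonempty (EKL.Coordinates (EKL.invariantOrigin ρ) (Module.finrank K V)) ∧
    ∀ (x : EKL.Coordinates (EKL.originPoint K V) (Module.finrank K V))
      (y : EKL.Coordinates (EKL.invariantOrigin ρ) (Module.finrank K V)),
      Even (EKL.localDegree (EKL.components (EKL.invariantRing ρ).val x y)) ∧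
      EKL.HasEKLDegree (EKL.components (EKL.invariantRing ρ).val x y)
        ((EKL.localDegree (EKL.components (EKL.invariantRing ρ).val x y) / 2) •
          (EKL.GW.unit (1 : Kˣ) + EKL.GW.unit (-1 : Kˣ))) := by
  have h2 : (2 : K) ≠ 0 := Ring.two_ne_zero hK
  obtain ⟨e⟩ := hpoly
  obtain ⟨e'⟩ := EKL.nonempty_algEquiv_invariantRing ρ e
  refine ⟨EKL.nonempty_coordinates _ (EKL.polyFunEquiv K V), EKL.nonempty_coordinates _ e',
    fun x y => ?_⟩
  obtain ⟨g, hg⟩ := hrefl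
  obtain ⟨hinv, α, hα, hα0, hgα, hdvd⟩ := EKL.exists_polyAction_reflection h2 ρ hg
  set f := EKL.components (EKL.invariantRing ρ).val x y
  have hfx : ∀ i, x.equiv (f i) = (y.equiv (MvPolynomial.X i)).1 := fun i =>
    x.equiv.apply_symm_apply _
  -- the components generate the ideal of all invariants which vanish at the origin
  have hmem : ∀ r ∈ EKL.invariantRing ρ, EKL.originPoint K V r = 0 →
      x.equiv.symm r ∈ Ideal.span (Set.range f) := by
    intro r hr hr0
    obtain ⟨p, hp⟩ := y.equiv.surjective ⟨r, hr⟩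
    have hp0 : MvPolynomial.constantCoeff p = 0 := by
      rw [← y.apply_equiv, hp]
      exact hr0
    obtain ⟨c, rfl⟩ := EKL.exists_sum_mul_X_of_constantCoeff_eq_zero hp0
    have : r = ∑ j, (y.equiv (c j)).1 * (y.equiv (MvPolynomial.X j)).1 := by
      have := congrArg Subtype.val hp
      simpa using this.symm
    rw [this, map_sum]
    refine Ideal.sum_mem _ fun j _ => ?_
    rw [map_mul]
    exact Ideal.mul_mem_left _ _ (Ideal.subset_span ⟨j, rfl⟩)
  have hpow : ∀ i, ∃ N, (MvPolynomial.X i : MvPolynomial (Fin _) K) ^ N ∈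
      Ideal.span (Set.range f) := by
    intro i
    obtain ⟨N, hN⟩ := EKL.exists_pow_mem_span_invariants ρ (x.origin i)
    refine ⟨N, ?_⟩
    have hle : Ideal.span {r : EKL.PolyFun K V | r ∈ EKL.invariantRing ρ ∧
        EKL.originPoint K V r = 0} ≤ (Ideal.span (Set.range f)).comap x.equiv.symm :=
      Ideal.span_le.2 fun r hr => hmem r hr.1 hr.2
    simpa using hle hN
  refine EKL.hasEKLDegree_of_involution h2 f hpow (fun i => ?_)
    ((x.equiv.symm.toAlgHom.comp (EKL.polyAction ρ g)).comp x.equiv.toAlgHom) (fun p => ?_)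
    (fun i => ?_) (x.equiv.symm α) ?_ ?_ ?_ (fun p => ?_)
  · rw [← x.apply_equiv, hfx]
    exact y.origin i
  · simp [hinv]
  · have := (y.equiv (MvPolynomial.X i)).2 g
    simp [this, f, EKL.components]
  · simpa using hα
  · rw [← x.apply_equiv]
    simpa using hα0
  · simp [hgα]
  · have := map_dvd x.equiv.symm (hdvd (x.equiv p))
    simpa using this
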